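/- Let $S^1=\mathbb R/2\pi\mathbb Z$, let $\mathbb E^2$ be the Euclidean plane, and let $$\hat{\mathcal M}=\{\hat\gamma:S^1\to\mathbb E^2 \text{ smooth}\mid \langle\hat\gamma_s,\hat\gamma_s\rangle\equiv 1\}$$ be the space of closed unit-speed plane curves. For $\hat\gamma\in\hat{\mathcal M}$ let $T=\hat\gamma_s$, let $N$ be the left-oriented unit normal, and let $\hat\kappa$ be the curvature, $T_s=\hat\kappa N$. A motion is a one-parameter family $t\mapsto\hat\gamma(\cdot,t)\in\hat{\mathcal M}$, $t\in\mathbb R$, that is smooth in $(s,t)$. The tangent space is $$T_{\hat\gamma}\hat{\mathcal M}=\{\lambda T+\mu N\mid \lambda,\mu:S^1\to\mathbb R\text{ smooth},\ \lambda_s=\hat\kappa\mu\},$$ and the differential of a function $F$ on $\hat{\mathcal M}$ is given by $dF(Y)=\frac{d}{dt}\big|_{t=0}F(\hat\gamma(\cdot,t))$ for any motion with $\hat\gamma(\cdot,0)=\hat\gamma$ and $\hat\gamma_t(\cdot,0)=Y$. Define $$\hat\omega_1(X,Y)=\frac12\int_{S^1}\langle D_sX,D_s^2Y\rangle\,ds,\qquad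 D_s=\frac{\partial}{\partial s},\quad X,Y\in T_{\hat\gamma}\hat{\mathcal M},$$ and $\hat H_1(\hat\gamma)=\int_{S^1}\frac14\hat\kappa^2\,ds$. Let $S^1$ act on $\hat{\mathcal M}$ by $\sigma\cdot\hat\gamma=\hat\gamma(\cdot+\sigma)$, and for $A\in\mathrm{Lie}(S^1)=\mathbb R\,\frac{\partial}{\partial\sigma}$ let $\underline A$ be the fundamental vector field, so that $\underline{A}_{\hat\gamma}=a\hat\gamma_s$ for $A=a\frac{\partial}{\partial\sigma}$. **Theorem.** 1. For each $\hat\gamma\in\hat{\mathcal M}$, $T_{\hat\gamma}\hat{\mathcal M}$ is exactly the set of the velocities $\hat\gamma_t(\cdot,0)$ of motions with $\hat\gamma(\cdot,0)=\hat\gamma$. 2. For $X=\lambda T+\mu N$ and $Y=\tilde\lambda T+\tilde\mu N$ in $T_{\hat\gamma}\hat{\mathcal M}$, $$\hat\omega_1(X,Y)=\int_{S^1}(\hat\kappa\lambda+\mu_s)\,\hat\Omega\tilde\mu\,ds,\qquad \hat\Omega\tilde\mu=\tfrac12\big(\tilde\mu_{ss}+\hat\kappa^2\tilde\mu+\hat\kappa_s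 D_s^{-1}(\hat\kappa\tilde\mu)\big),$$ where $D_s^{-1}(\hat\kappa\tilde\mu)$ is taken to be the primitive $\tilde\lambda$. 3. The $S^1$-action preserves $\hat\omega_1$: for $X,Y\in T_{\hat\gamma}\hat{\mathcal M}$ and $\sigma\in S^1$, the translates $X(\cdot+\sigma)$, $Y(\cdot+\sigma)$ lie in $T_{\sigma\cdot\hat\gamma}\hat{\mathcal M}$, and $\hat\omega_1(X(\cdot+\sigma),Y(\cdot+\sigma))=\hat\omega_1(X,Y)$. 4. The fundamental vector fields are tangent to $\hat{\mathcal M}$, and the $S^1$-action has a moment map $\hat\mu_1:\hat{\mathcal M}\to\mathrm{Lie}(S^1)^*$ with respect to $\hat\omega_1$ that is given by $$\hat\mu_1(\hat\gamma)\Big(\frac{\partial}{\partial\sigma}\Big)=\hat H_1(\hat\gamma),\qquad\hat\gamma\in\hat{\mathcal M}.$$ That is, $\hat\mu_1$ is $S^1$-invariant, and $d\big(\hat\mu_1(\cdot)(A)\big)=\hat\omega_1(\underline A,\,\cdot\,)$ on $T_{\hat\gamma}\hat{\mathcal M}$ for all $A\in\mathrm{Lie}(S^1)$ and $\hat\gamma\in\hat{\mathcal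 M}$. -/

import Mathlib

open scoped ContDiff RealInnerProductSpace
open MeasureTheory

namespace PlaneCurves

noncomputable section

/-- The circle `S¹ = ℝ / 2πℤ`, with its quotient measure of total mass `2π`. -/
abbrev S1 : Type := AddCircle (2 * Real.pi)

/-- The total length `2π` of the circle is positive. -/
instance factTwoPiPos : Fact (0 < 2 * Real.pi) := ⟨Real.two_pi_pos⟩

/-- The Euclidean plane. -/
abbrev E2 : Type := EuclideanSpace ℝ (Fin 2)

/-- Smoothness of a map on the circle, i.e. of its `2π`-periodic lift to `ℝ`. -/
def Smooth {V : Type} [NormedAddCommGroup V] [NormedSpace ℝ V] (f : S1 → V) : Prop :=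
  ContDiff ℝ ∞ (fun t : ℝ => f (t : S1))

/-- The derivative `D_s = ∂/∂s` of a map on the circle. -/
def Ds {V : Type} [NormedAddCommGroup V] [NormedSpace ℝ V] (f : S1 → V) : S1 → V :=
  fun s => deriv (fun h : ℝ => f (s + (h : S1))) 0

/-- The translate `f(· + σ)` of a map on the circle. -/
def shift {V : Type} (σ : S1) (f : S1 → V) : S1 → V := fun s => f (s + σ)

/-- The space of smooth closed plane curves `S¹ → 𝔼²` of unit speed. -/
def MHat : Set (S1 → E2) := {γ | Smooth γ ∧ ∀ s, ⟪Ds γ s, Ds γ s⟫ = 1}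

theorem Ds_shift {V : Type} [NormedAddCommGroup V] [NormedSpace ℝ V] (σ : S1) (f : S1 → V) :
    Ds (shift σ f) = shift σ (Ds f) := by
  funext s
  simp only [Ds, shift, add_right_comm]

theorem Smooth.shift {V : Type} [NormedAddCommGroup V] [NormedSpace ℝ V] {f : S1 → V}
    (hf : Smooth f) (σ : S1) : Smooth (shift σ f) := by
  induction σ using QuotientAddGroup.induction_on with
  | H c =>
    have h : ContDiff ℝ ∞ (fun t : ℝ => t + c) := contDiff_id.add contDiff_const
    exact ContDiff.comp (g := fun t : ℝ => f (t : S1)) hf h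

theorem shift_mem_MHat (σ : S1) {γ : S1 → E2} (hγ : γ ∈ MHat) : shift σ γ ∈ MHat :=
  ⟨hγ.1.shift σ, fun s => by rw [Ds_shift]; exact hγ.2 (s + σ)⟩

/-- The action of `S¹` on the space of closed unit-speed curves, `σ · γ = γ(· + σ)`. -/
instance curveAction : AddAction S1 MHat where
  vadd σ γ := ⟨shift σ γ.1, shift_mem_MHat σ γ.2⟩
  zero_vadd γ := Subtype.ext (funext fun s => congrArg γ.1 (add_zero s))
  add_vadd σ τ γ := Subtype.ext (funext fun s => congrArg γ.1 (add_assoc s σ τ).symm)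

/-- The rotation by `+π/2`. -/
def rot (v : E2) : E2 := !₂[-v 1, v 0]

/-- The unit tangent `T = γ_s`. -/
def tangent (γ : MHat) : S1 → E2 := Ds γ.1

/-- The left-oriented unit normal `N`. -/
def normal (γ : MHat) : S1 → E2 := fun s => rot (tangent γ s)

/-- The curvature. Since `T` has unit length, `T_s` is a multiple of the unit vector `N`, so this
is the function `κ` with `T_s = κ N`. -/
def curvature (γ : MHat) : S1 → ℝ := fun s => ⟪Ds (tangent γ) s, normal γ s⟫

/-- The vector field `λ T + μ N` along `γ`. -/
def frameField (γ : MHat) (lam mu : S1 → ℝ) : S1 → E2 :=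
  fun s => lam s • tangent γ s + mu s • normal γ s

/-- `(λ, μ)` are the frame components of a tangent vector at `γ`: smooth, with `λ_s = κ μ`. -/
def IsTangentPair (γ : MHat) (lam mu : S1 → ℝ) : Prop :=
  Smooth lam ∧ Smooth mu ∧ ∀ s, Ds lam s = curvature γ s * mu s

/-- The tangent space at `γ`: all fields `λ T + μ N` with `λ, μ` smooth and `λ_s = κ μ`. -/
def tangentSpace (γ : MHat) : Set (S1 → E2) :=
  {X | ∃ lam mu : S1 → ℝ, IsTangentPair γ lam mu ∧ X = frameField γ lam mu}

/-- A smooth one-parameter family of closed unit-speed curves (smooth jointly in `t` and `s`). -/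
def IsMotion (Γ : ℝ → MHat) : Prop :=
  ContDiff ℝ ∞ (fun p : ℝ × ℝ => (Γ p.1).1 (p.2 : S1))

/-- The motion vector field `γ_t` at `t = 0`. -/
def initialVelocity (Γ : ℝ → MHat) : S1 → E2 := fun s => deriv (fun t : ℝ => (Γ t).1 s) 0

/-- The differential of `γ ↦ σ · γ` sends a tangent vector `Y` to its translate `Y(· + σ)`. -/
theorem initialVelocity_vadd (σ : S1) (Γ : ℝ → MHat) :
    initialVelocity (fun t => σ +ᵥ Γ t) = shift σ (initialVelocity Γ) := rfl

/-- `dF_γ = ℓ` on the tangent space at `γ`: the derivative of `F` along any smooth motion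
starting at `γ` with velocity `Y` exists and equals `ℓ Y`. -/
def HasDifferentialAt (F : MHat → ℝ) (γ : MHat) (ℓ : (S1 → E2) → ℝ) : Prop :=
  ∀ Y ∈ tangentSpace γ, ∀ Γ : ℝ → MHat, IsMotion Γ → Γ 0 = γ → initialVelocity Γ = Y →
    HasDerivAt (fun t => F (Γ t)) (ℓ Y) 0

/-- The form `ω̂₁(X, Y) = ½ ∫ ⟨D_s X, D_s² Y⟩ ds`. -/
def omegaHat1 (X Y : S1 → E2) : ℝ := (1 / 2) * ∫ s : S1, ⟪Ds X s, Ds (Ds Y) s⟫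

/-- The recursion operator `Ω̂ μ = ½ (μ_ss + κ² μ + κ_s D_s⁻¹(κ μ))` of the mKdV equation, where
`D_s⁻¹(κ μ)` is the given primitive `lam` of `κ μ`. -/
def OmegaHat (γ : MHat) (lam mu : S1 → ℝ) : S1 → ℝ := fun s =>
  (1 / 2) * (Ds (Ds mu) s + curvature γ s ^ 2 * mu s + Ds (curvature γ) s * lam s)

/-- The functional `Ĥ₁ = ∫ ¼ κ² ds`. -/
def HHat1 (γ : MHat) : ℝ := ∫ s : S1, (1 / 4) * curvature γ s ^ 2

/-- The fundamental vector field of `a · ∂/∂σ ∈ Lie(S¹)`, where `Lie(S¹)` is identified with `ℝ`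
by `∂/∂σ ↦ 1` (so that the exponential map is the projection `ℝ → S¹`). -/
def fundamentalField (a : ℝ) (γ : MHat) : S1 → E2 := fun s =>
  deriv (fun τ : ℝ => (((τ * a : ℝ) : S1) +ᵥ γ).1 s) 0

/-- `μ : MHat → Lie(S¹)*` is a moment map for the `S¹`-action with respect to the two-form `form`:
`d⟨μ, A⟩ = form(A̲, ·)` for each `A ∈ Lie(S¹)`, and `μ` is equivariant, which means invariant since
`S¹` is commutative. -/
structure IsMomentMap (form : (S1 → E2) → (S1 → E2) → ℝ) (μ : MHat → Module.Dual ℝ ℝ) : Prop where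
  differential : ∀ (a : ℝ) (γ : MHat),
    HasDifferentialAt (fun δ => μ δ a) γ (fun Y => form (fundamentalField a γ) Y)
  equivariant : ∀ (σ : S1) (γ : MHat), μ (σ +ᵥ γ) = μ γ

end

end PlaneCurves

/-!
Differentiating `|γ_s|² = 1` shows that the velocity `Y` of a motion satisfies `⟨Y_s, T⟩ = 0`, and
the smooth fields with this property are exactly those of the form `λ T + μ N` with `λ_s = κ μ`.
Conversely, if `⟨Y_s, T⟩ = 0`, then the curves `γ + t Y` have speed `√(1 + t² |Y_s|²)`, which is
even in `t`. Scaling them to length `2π` and parametrising them by arclength gives a motion. The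
scale factor and the arclength parameter are even in `t` as well, so they are stationary at `t = 0`
and the initial velocity is still `Y`.

The formula for `ω̂₁` follows from `X_s = (κ λ + μ_s) N` and `(κ λ + μ_s)_s = 2 Ω̂ μ`. Since
`κ² = ⟨T_s, T_s⟩` and `∂_t T = Y_s`, differentiating `Ĥ₁` under the integral sign gives
`½ ∫ ⟨T_s, Y_ss⟩ ds = ω̂₁(T, Y)`, and `T` is the fundamental vector field of `∂/∂σ`.
-/

namespace PlaneCurves

noncomputable section

section Calculus

variable {E V : Type*} [NormedAddCommGroup E] [NormedSpace ℝ E]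
  [NormedAddCommGroup V] [NormedSpace ℝ V]

/-- The derivative of `G` in the constant direction `v`, as a function of the base point, so that
the partial derivatives of a function on `ℝ × ℝ` are `dirDeriv (1, 0) G` and `dirDeriv (0, 1) G`. -/
def dirDeriv (v : E) (G : E → V) : E → V := fun p => fderiv ℝ G p v

theorem contDiff_dirDeriv {G : E → V} (hG : ContDiff ℝ ∞ G) (v : E) :
    ContDiff ℝ ∞ (dirDeriv v G) :=
  (hG.fderiv_right (by simp)).clm_apply contDiff_const

theorem dirDeriv_comm {G : E → V} (hG : ContDiff ℝ 2 G) (v w : E) :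
    dirDeriv v (dirDeriv w G) = dirDeriv w (dirDeriv v G) := by
  funext p
  have hd : DifferentiableAt ℝ (fderiv ℝ G) p :=
    (hG.fderiv_right (m := 1) (by norm_num)).differentiable one_ne_zero p
  have second_deriv (a b : E) : dirDeriv a (dirDeriv b G) p = fderiv ℝ (fderiv ℝ G) p a b := by
    change fderiv ℝ (fun q => fderiv ℝ G q b) p a = _
    rw [fderiv_clm_apply hd (differentiableAt_const b)]
    simp
  have hsymm : IsSymmSndFDerivAt ℝ G p := hG.contDiffAt.isSymmSndFDerivAt (by simp)
  rw [second_deriv, second_deriv, hsymm]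

theorem hasDerivAt_dirDeriv_fst {G : ℝ × E → V} (hG : Differentiable ℝ G) (t : ℝ) (y : E) :
    HasDerivAt (fun t => G (t, y)) (dirDeriv (1, 0) G (t, y)) t :=
  (hG (t, y)).hasFDerivAt.comp_hasDerivAt t ((hasDerivAt_id t).prodMk (hasDerivAt_const t y))

theorem hasDerivAt_dirDeriv_snd {G : E × ℝ → V} (hG : Differentiable ℝ G) (x : E) (s : ℝ) :
    HasDerivAt (fun s => G (x, s)) (dirDeriv (0, 1) G (x, s)) s :=
  (hG (x, s)).hasFDerivAt.comp_hasDerivAt s ((hasDerivAt_const s x).prodMk (hasDerivAt_id s))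

theorem periodic_dirDeriv_snd {G : E × ℝ → V} (hG : Differentiable ℝ G) {c : ℝ} {x : E}
    (hper : Function.Periodic (fun s => G (x, s)) c) :
    Function.Periodic (fun s => dirDeriv (0, 1) G (x, s)) c := fun s => by
  have h := (hasDerivAt_dirDeriv_snd hG x (s + c)).comp_add_const s c
  rw [funext hper] at h
  exact h.unique (hasDerivAt_dirDeriv_snd hG x s)

theorem hasDerivAt_zero_of_even {f : ℝ → V} (hf : Function.Even f)
    (hd : DifferentiableAt ℝ f 0) : HasDerivAt f 0 0 := by
  have : IsAddTorsionFree V := .of_isTorsionFree ℝ V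
  have h := deriv_comp_neg f 0
  rw [funext hf, neg_zero] at h
  exact hd.hasDerivAt.congr_deriv (self_eq_neg.1 h)

section ParametricIntegral

variable [FiniteDimensional ℝ E]

theorem hasFDerivAt_intervalIntegral {f : E × ℝ → V} (hf : ContDiff ℝ 1 f) (a b : ℝ) (x : E) :
    HasFDerivAt (fun x => ∫ s in a..b, f (x, s))
      (∫ s in a..b, fderiv ℝ f (x, s) ∘L .inl ℝ E ℝ) x := by
  have : ProperSpace E := FiniteDimensional.proper ℝ E
  have hf' : Continuous fun p : E × ℝ => fderiv ℝ f p ∘L .inl ℝ E ℝ :=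
    (hf.continuous_fderiv one_ne_zero).clm_comp continuous_const
  obtain ⟨C, hC⟩ := ((isCompact_closedBall x 1).prod (isCompact_uIcc (a := a) (b := b))
    ).exists_bound_of_continuousOn hf'.continuousOn
  refine intervalIntegral.hasFDerivAt_integral_of_dominated_of_fderiv_le (bound := fun _ => C)
    (F' := fun x s => fderiv ℝ f (x, s) ∘L .inl ℝ E ℝ) (Metric.ball_mem_nhds x one_pos)
    (.of_forall fun y => (hf.continuous.comp (.prodMk_right y)).aestronglyMeasurable)
    ((hf.continuous.comp (.prodMk_right x)).intervalIntegrable _ _)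
    (hf'.comp (.prodMk_right x)).aestronglyMeasurable
    (.of_forall fun s hs y hy => hC (y, s) ⟨Metric.ball_subset_closedBall hy,
      Set.uIoc_subset_uIcc hs⟩)
    intervalIntegrable_const
    (.of_forall fun s _ y _ => ?_)
  exact (hf.differentiable one_ne_zero (y, s)).hasFDerivAt.comp y (hasFDerivAt_prodMk_left y s)

theorem dirDeriv_intervalIntegral {f : E × ℝ → V} (hf : ContDiff ℝ 1 f) (a b : ℝ) (v : E) :
    dirDeriv v (fun x => ∫ s in a..b, f (x, s)) =
      fun x => ∫ s in a..b, dirDeriv (v, 0) f (x, s) := by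
  funext x
  have hf' : Continuous fun s => fderiv ℝ f (x, s) ∘L .inl ℝ E ℝ :=
    ((hf.continuous_fderiv one_ne_zero).comp (.prodMk_right x)).clm_comp continuous_const
  rw [dirDeriv, (hasFDerivAt_intervalIntegral hf a b x).fderiv,
    ContinuousLinearMap.intervalIntegral_apply (hf'.intervalIntegrable _ _)]
  rfl

theorem contDiff_intervalIntegral {f : E × ℝ → V} (hf : ContDiff ℝ ∞ f) (a b : ℝ) :
    ContDiff ℝ ∞ (fun x => ∫ s in a..b, f (x, s)) := by
  refine contDiff_infty.2 fun n => ?_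
  induction n generalizing f with
  | zero =>
    exact contDiff_zero.2 (continuous_iff_continuousAt.2 fun x =>
      (hasFDerivAt_intervalIntegral (hf.of_le (by simp)) a b x).continuousAt)
  | succ n ih =>
    have hf₁ : ContDiff ℝ 1 f := hf.of_le (by simp)
    refine contDiff_succ_iff_fderiv_apply.2
      ⟨fun x => (hasFDerivAt_intervalIntegral hf₁ a b x).differentiableAt,
        fun h => absurd h (WithTop.natCast_ne_top n), fun v => ?_⟩
    change ContDiff ℝ n (dirDeriv v fun x => ∫ s in a..b, f (x, s))
    rw [dirDeriv_intervalIntegral hf₁]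
    exact ih (contDiff_dirDeriv hf (v, 0))

theorem contDiff_primitive {f : E × ℝ → V} (hf : ContDiff ℝ ∞ f) :
    ContDiff ℝ ∞ (fun p : E × ℝ => ∫ s in (0 : ℝ)..p.2, f (p.1, s)) := by
  have rescale : (fun p : E × ℝ => ∫ s in (0 : ℝ)..p.2, f (p.1, s)) =
      fun p => p.2 • ∫ s in (0 : ℝ)..1, f (p.1, s * p.2) := by
    funext p
    rw [intervalIntegral.smul_integral_comp_mul_right (fun s => f (p.1, s)), zero_mul, one_mul]
  rw [rescale]
  exact contDiff_snd.smul (contDiff_intervalIntegral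
    (f := fun q : (E × ℝ) × ℝ => f (q.1.1, q.2 * q.1.2)) (hf.comp (by fun_prop)) 0 1)

theorem hasDerivAt_intervalIntegral {f : ℝ × ℝ → V} (hf : ContDiff ℝ 1 f) (a b t : ℝ) :
    HasDerivAt (fun t => ∫ s in a..b, f (t, s)) (∫ s in a..b, dirDeriv (1, 0) f (t, s)) t :=
  (hasFDerivAt_intervalIntegral hf a b t).differentiableAt.hasFDerivAt.hasDerivAt.congr_deriv
    (congrFun (dirDeriv_intervalIntegral hf a b 1) t)

theorem hasDerivAt_intervalIntegral_inner_self {F : Type*} [NormedAddCommGroup F]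
    [InnerProductSpace ℝ F] {K : ℝ × ℝ → F} (hK : ContDiff ℝ 1 K) (a b t : ℝ) :
    HasDerivAt (fun t => ∫ s in a..b, ⟪K (t, s), K (t, s)⟫)
      (2 * ∫ s in a..b, ⟪K (t, s), dirDeriv (1, 0) K (t, s)⟫) t := by
  have hf : ContDiff ℝ 1 fun p => ⟪K p, K p⟫ := hK.inner ℝ hK
  have integrand_deriv (s : ℝ) : dirDeriv (1, 0) (fun p => ⟪K p, K p⟫) (t, s) =
      2 * ⟪K (t, s), dirDeriv (1, 0) K (t, s)⟫ := by
    have hd := hasDerivAt_dirDeriv_fst (hK.differentiable one_ne_zero) t s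
    rw [(hasDerivAt_dirDeriv_fst (hf.differentiable one_ne_zero) t s).unique (hd.inner ℝ hd),
      real_inner_comm (K (t, s)), two_mul]
  refine (hasDerivAt_intervalIntegral hf a b t).congr_deriv ?_
  simp only [integrand_deriv, intervalIntegral.integral_const_mul]

end ParametricIntegral

theorem contDiff_equiv_symm_of_hasFDerivAt [CompleteSpace E] {n : WithTop ℕ∞} (hn : n ≠ 0)
    (Φ : E ≃ V) (hΦ : ContDiff ℝ n Φ) {Φ' : E → E ≃L[ℝ] V}
    (hΦ' : ∀ p, HasFDerivAt Φ (Φ' p : E →L[ℝ] V) p) : ContDiff ℝ n Φ.symm := by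
  have hopen : IsOpenMap Φ := isOpenMap_of_hasStrictFDerivAt_equiv fun p =>
    hΦ.contDiffAt.hasStrictFDerivAt' (hΦ' p) hn
  exact (Φ.toHomeomorphOfContinuousOpen hΦ.continuous hopen).contDiff_symm hΦ' hΦ

theorem exists_contDiff_fiberwise_inverse [CompleteSpace E] {n : WithTop ℕ∞} (hn : n ≠ 0)
    {f : E × ℝ → ℝ} (hf : ContDiff ℝ n f) (hpos : ∀ p, 0 < dirDeriv (0, 1) f p)
    (hsurj : ∀ x, Function.Surjective fun s => f (x, s)) :
    ∃ θ : E × ℝ → ℝ, ContDiff ℝ n θ ∧ ∀ x s, θ (x, f (x, s)) = s := by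
  have hd : Differentiable ℝ f := hf.differentiable hn
  have hinj (x : E) : Function.Injective fun s => f (x, s) :=
    (strictMono_of_hasDerivAt_pos (hasDerivAt_dirDeriv_snd hd x) fun s => hpos (x, s)).injective
  let Φ : E × ℝ ≃ E × ℝ := Equiv.prodShear (Equiv.refl E) fun x =>
    Equiv.ofBijective _ ⟨hinj x, hsurj x⟩
  have hΦ : ContDiff ℝ n Φ := contDiff_fst.prodMk hf
  let Φ' (p : E × ℝ) : (E × ℝ) ≃L[ℝ] E × ℝ := (ContinuousLinearEquiv.refl ℝ E).skewProd
    (ContinuousLinearEquiv.unitsEquivAut ℝ (Units.mk0 _ (hpos p).ne')) (fderiv ℝ f p ∘L .inl ℝ E ℝ)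
  have hΦ' (p : E × ℝ) : HasFDerivAt Φ (Φ' p : E × ℝ →L[ℝ] E × ℝ) p := by
    refine (hasFDerivAt_fst.prodMk (hd p).hasFDerivAt).congr_fderiv ?_
    ext <;> simp [Φ', dirDeriv, ← Prod.zero_eq_mk]
  exact ⟨fun q => (Φ.symm q).2, (contDiff_equiv_symm_of_hasFDerivAt hn Φ hΦ hΦ').snd,
    fun x s => congrArg Prod.snd (Φ.symm_apply_apply (x, s))⟩

end Calculus

section Circle

variable {V W : Type} [NormedAddCommGroup V] [NormedSpace ℝ V]
  [NormedAddCommGroup W] [NormedSpace ℝ W]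

theorem Ds_coe (f : S1 → V) (t : ℝ) : Ds f (t : S1) = deriv (fun x : ℝ => f (x : S1)) t := by
  have h := deriv_comp_const_add (f := fun x : ℝ => f (x : S1)) t 0
  simpa only [Ds, AddCircle.coe_add, add_zero] using h

theorem Smooth.hasDerivAt {f : S1 → V} (hf : Smooth f) (t : ℝ) :
    HasDerivAt (fun x : ℝ => f (x : S1)) (Ds f (t : S1)) t := by
  rw [Ds_coe]
  exact (ContDiff.differentiable hf (by simp) t).hasDerivAt

theorem Ds_eq_of_hasDerivAt {f : S1 → V} {v : V} {t : ℝ}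
    (h : HasDerivAt (fun x : ℝ => f (x : S1)) v t) : Ds f (t : S1) = v :=
  (Ds_coe f t).trans h.deriv

theorem Smooth.ds {f : S1 → V} (hf : Smooth f) : Smooth (Ds f) := by
  rw [Smooth, funext (Ds_coe f)]
  exact (contDiff_infty_iff_deriv.1 hf).2

theorem smooth_const (c : V) : Smooth (fun _ => c) := contDiff_const

theorem Smooth.add {f g : S1 → V} (hf : Smooth f) (hg : Smooth g) :
    Smooth (fun s => f s + g s) := ContDiff.add hf hg

theorem Smooth.smul {f : S1 → ℝ} {g : S1 → V} (hf : Smooth f) (hg : Smooth g) :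
    Smooth (fun s => f s • g s) := ContDiff.smul hf hg

theorem Smooth.clm_apply (L : V →L[ℝ] W) {f : S1 → V} (hf : Smooth f) :
    Smooth (fun s => L (f s)) := L.contDiff.comp (f := fun t : ℝ => f (t : S1)) hf

theorem Ds_const (c : V) (s : S1) : Ds (fun _ : S1 => c) s = 0 := by simp [Ds]

theorem Ds_add {f g : S1 → V} (hf : Smooth f) (hg : Smooth g) (s : S1) :
    Ds (fun s => f s + g s) s = Ds f s + Ds g s := by
  obtain ⟨t, rfl⟩ := QuotientAddGroup.mk_surjective s
  exact Ds_eq_of_hasDerivAt ((hf.hasDerivAt t).add (hg.hasDerivAt t))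

theorem Ds_smul {f : S1 → ℝ} {g : S1 → V} (hf : Smooth f) (hg : Smooth g) (s : S1) :
    Ds (fun s => f s • g s) s = f s • Ds g s + Ds f s • g s := by
  obtain ⟨t, rfl⟩ := QuotientAddGroup.mk_surjective s
  exact Ds_eq_of_hasDerivAt ((hf.hasDerivAt t).smul (hg.hasDerivAt t))

theorem Ds_clm_apply (L : V →L[ℝ] W) {f : S1 → V} (hf : Smooth f) (s : S1) :
    Ds (fun s => L (f s)) s = L (Ds f s) := by
  obtain ⟨t, rfl⟩ := QuotientAddGroup.mk_surjective s
  exact Ds_eq_of_hasDerivAt (L.hasFDerivAt.comp_hasDerivAt t (hf.hasDerivAt t))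

theorem Ds_const_smul {f : S1 → V} (hf : Smooth f) (a : ℝ) (s : S1) :
    Ds (fun s => a • f s) s = a • Ds f s :=
  Ds_clm_apply (a • ContinuousLinearMap.id ℝ V) hf s

theorem integral_eq_intervalIntegral (f : S1 → V) :
    ∫ s, f s = ∫ s in (0 : ℝ)..(2 * Real.pi), f (s : S1) := by
  rw [← AddCircle.intervalIntegral_preimage (2 * Real.pi) 0 f, zero_add]

end Circle

section CircleInner

variable {V : Type} [NormedAddCommGroup V] [InnerProductSpace ℝ V] {f g : S1 → V}

theorem Smooth.inner (hf : Smooth f) (hg : Smooth g) : Smooth (fun s => ⟪f s, g s⟫) :=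
  ContDiff.inner ℝ hf hg

theorem Ds_inner (hf : Smooth f) (hg : Smooth g) (s : S1) :
    Ds (fun s => ⟪f s, g s⟫) s = ⟪f s, Ds g s⟫ + ⟪Ds f s, g s⟫ := by
  obtain ⟨t, rfl⟩ := QuotientAddGroup.mk_surjective s
  exact Ds_eq_of_hasDerivAt ((hf.hasDerivAt t).inner ℝ (hg.hasDerivAt t))

theorem inner_Ds_self_of_inner_self_const (hf : Smooth f) {c : ℝ} (hc : ∀ s, ⟪f s, f s⟫ = c)
    (s : S1) : ⟪Ds f s, f s⟫ = 0 := by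
  have h := Ds_inner hf hf s
  rw [funext hc, Ds_const, real_inner_comm] at h
  linarith

end CircleInner

section Rotation

theorem inner_eq_sum_coords (v w : E2) : ⟪v, w⟫ = v 0 * w 0 + v 1 * w 1 := by
  simp [PiLp.inner_apply, Fin.sum_univ_two, mul_comm]

/-- The rotation `rot` by `+π/2` as a continuous linear map. -/
def rotL : E2 →L[ℝ] E2 :=
  LinearMap.toContinuousLinearMap
    { toFun := rot
      map_add' := fun v w => by ext i; fin_cases i <;> simp [rot]; ring
      map_smul' := fun c v => by ext i; fin_cases i <;> simp [rot] }

theorem rotL_apply (v : E2) : rotL v = rot v := rfl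

theorem inner_rot_self (v : E2) : ⟪v, rot v⟫ = 0 := by
  rw [inner_eq_sum_coords]; simp [rot]; ring

theorem inner_rot_rot (v w : E2) : ⟪rot v, rot w⟫ = ⟪v, w⟫ := by
  rw [inner_eq_sum_coords, inner_eq_sum_coords]; simp [rot]; ring

theorem rot_rot (v : E2) : rot (rot v) = -v := by
  ext i; fin_cases i <;> simp [rot]

theorem eq_inner_smul_add_inner_rot_smul {v : E2} (hv : ⟪v, v⟫ = 1) (x : E2) :
    x = ⟪x, v⟫ • v + ⟪x, rot v⟫ • rot v := by
  simp only [inner_eq_sum_coords] at *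
  ext i; fin_cases i <;> simp [rot]
  · linear_combination (-x 0) * hv
  · linear_combination (-x 1) * hv

end Rotation

section Frame

variable (γ : MHat)

theorem inner_tangent_tangent (s : S1) : ⟪tangent γ s, tangent γ s⟫ = 1 := γ.2.2 s

theorem norm_tangent (s : S1) : ‖tangent γ s‖ = 1 := by
  rw [norm_eq_sqrt_real_inner, inner_tangent_tangent, Real.sqrt_one]

theorem inner_normal_normal (s : S1) : ⟪normal γ s, normal γ s⟫ = 1 :=
  (inner_rot_rot _ _).trans (inner_tangent_tangent γ s)

theorem inner_normal_tangent (s : S1) : ⟪normal γ s, tangent γ s⟫ = 0 :=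
  (real_inner_comm _ _).trans (inner_rot_self _)

theorem smooth_tangent : Smooth (tangent γ) := γ.2.1.ds

theorem smooth_normal : Smooth (normal γ) := (smooth_tangent γ).clm_apply rotL

theorem smooth_curvature : Smooth (curvature γ) := (smooth_tangent γ).ds.inner (smooth_normal γ)

theorem Ds_tangent (s : S1) : Ds (tangent γ) s = curvature γ s • normal γ s := by
  have hT : ⟪Ds (tangent γ) s, tangent γ s⟫ = 0 :=
    inner_Ds_self_of_inner_self_const (smooth_tangent γ) (inner_tangent_tangent γ) s
  have expansion := eq_inner_smul_add_inner_rot_smul (inner_tangent_tangent γ s) (Ds (tangent γ) s)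
  rwa [hT, zero_smul, zero_add] at expansion

theorem Ds_normal (s : S1) : Ds (normal γ) s = -(curvature γ s • tangent γ s) := by
  refine (Ds_clm_apply rotL (smooth_tangent γ) s).trans ?_
  rw [Ds_tangent, map_smul, rotL_apply, normal, rot_rot, smul_neg]

variable {γ} {lam mu lam' mu' : S1 → ℝ}

theorem IsTangentPair.smooth_frameField (h : IsTangentPair γ lam mu) :
    Smooth (frameField γ lam mu) :=
  (h.1.smul (smooth_tangent γ)).add (h.2.1.smul (smooth_normal γ))

theorem IsTangentPair.Ds_frameField (h : IsTangentPair γ lam mu) :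
    Ds (frameField γ lam mu) = fun s => (curvature γ s * lam s + Ds mu s) • normal γ s := by
  funext s
  refine (Ds_add (h.1.smul (smooth_tangent γ)) (h.2.1.smul (smooth_normal γ)) s).trans ?_
  rw [Ds_smul h.1 (smooth_tangent γ), Ds_smul h.2.1 (smooth_normal γ), Ds_tangent, Ds_normal,
    h.2.2]
  module

theorem mem_tangentSpace_iff {Y : S1 → E2} :
    Y ∈ tangentSpace γ ↔ Smooth Y ∧ ∀ s, ⟪Ds Y s, tangent γ s⟫ = 0 := by
  constructor
  · rintro ⟨lam, mu, h, rfl⟩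
    refine ⟨h.smooth_frameField, fun s => ?_⟩
    rw [h.Ds_frameField, real_inner_smul_left, inner_normal_tangent, mul_zero]
  · rintro ⟨hY, horth⟩
    refine ⟨fun s => ⟪Y s, tangent γ s⟫, fun s => ⟪Y s, normal γ s⟫,
      ⟨hY.inner (smooth_tangent γ), hY.inner (smooth_normal γ), fun s => ?_⟩,
      funext fun s => eq_inner_smul_add_inner_rot_smul (inner_tangent_tangent γ s) (Y s)⟩
    rw [Ds_inner hY (smooth_tangent γ), horth, Ds_tangent, real_inner_smul_right, add_zero]

theorem IsTangentPair.smooth_normalRate (h : IsTangentPair γ lam mu) :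
    Smooth (fun s => curvature γ s * lam s + Ds mu s) :=
  ((smooth_curvature γ).smul h.1).add h.2.1.ds

theorem IsTangentPair.Ds_normalRate (h : IsTangentPair γ lam mu) (s : S1) :
    Ds (fun s => curvature γ s * lam s + Ds mu s) s = 2 * OmegaHat γ lam mu s := by
  have product_rule := Ds_smul (smooth_curvature γ) h.1 s
  refine (Ds_add ((smooth_curvature γ).smul h.1) h.2.1.ds s).trans ?_
  rw [product_rule, h.2.2, smul_eq_mul, smul_eq_mul, OmegaHat]
  ring

theorem omegaHat1_frameField (h : IsTangentPair γ lam mu) (h' : IsTangentPair γ lam' mu') :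
    omegaHat1 (frameField γ lam mu) (frameField γ lam' mu') =
      ∫ s : S1, (curvature γ s * lam s + Ds mu s) * OmegaHat γ lam' mu' s := by
  rw [omegaHat1, h.Ds_frameField, h'.Ds_frameField, ← integral_const_mul]
  congr with s
  rw [Ds_smul h'.smooth_normalRate (smooth_normal γ), h'.Ds_normalRate, Ds_normal]
  simp only [inner_add_right, real_inner_smul_left, real_inner_smul_right, inner_neg_right,
    inner_normal_tangent, inner_normal_normal]
  ring

end Frame

section Action

theorem tangent_vadd (σ : S1) (γ : MHat) : tangent (σ +ᵥ γ) = shift σ (tangent γ) := Ds_shift σ γ.1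

theorem curvature_vadd (σ : S1) (γ : MHat) : curvature (σ +ᵥ γ) = shift σ (curvature γ) := by
  funext s
  simp only [curvature, normal, tangent_vadd, Ds_shift, shift]

theorem shift_mem_tangentSpace {γ : MHat} {X : S1 → E2} (hX : X ∈ tangentSpace γ) (σ : S1) :
    shift σ X ∈ tangentSpace (σ +ᵥ γ) := by
  obtain ⟨hsmooth, horth⟩ := mem_tangentSpace_iff.1 hX
  refine mem_tangentSpace_iff.2 ⟨hsmooth.shift σ, fun s => ?_⟩
  rw [Ds_shift, tangent_vadd]
  exact horth (s + σ)

theorem omegaHat1_shift (σ : S1) (X Y : S1 → E2) :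
    omegaHat1 (shift σ X) (shift σ Y) = omegaHat1 X Y := by
  simp only [omegaHat1, Ds_shift]
  exact congrArg _ (integral_add_right_eq_self (fun s => ⟪Ds X s, Ds (Ds Y) s⟫) σ)

theorem HHat1_vadd (σ : S1) (γ : MHat) : HHat1 (σ +ᵥ γ) = HHat1 γ := by
  simp only [HHat1, curvature_vadd]
  exact integral_add_right_eq_self (fun s => (1 / 4) * curvature γ s ^ 2) σ

theorem fundamentalField_eq (a : ℝ) (γ : MHat) :
    fundamentalField a γ = fun s => a • tangent γ s := by
  funext s
  obtain ⟨t, rfl⟩ := QuotientAddGroup.mk_surjective s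
  have hline : HasDerivAt (fun τ : ℝ => t + τ * a) a 0 := by
    simpa using ((hasDerivAt_id (0 : ℝ)).mul_const a).const_add t
  have hγ : HasDerivAt (fun x : ℝ => γ.1 (x : S1)) (tangent γ (t : S1)) (t + 0 * a) := by
    rw [zero_mul, add_zero]
    exact γ.2.1.hasDerivAt t
  exact (hγ.scomp 0 hline).deriv

theorem fundamentalField_mem_tangentSpace (a : ℝ) (γ : MHat) :
    fundamentalField a γ ∈ tangentSpace γ := by
  rw [fundamentalField_eq, mem_tangentSpace_iff]
  refine ⟨(smooth_const a).smul (smooth_tangent γ), fun s => ?_⟩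
  rw [Ds_const_smul (smooth_tangent γ), real_inner_smul_left, Ds_tangent, real_inner_smul_left,
    inner_normal_tangent, mul_zero, mul_zero]

end Action

section Motion

/-- The lift of a family of curves to a map of `(t, s) ∈ ℝ × ℝ`, which turns the derivatives along
the circle and in the parameter into partial derivatives. -/
def familyLift (Γ : ℝ → MHat) : ℝ × ℝ → E2 := fun p => (Γ p.1).1 (p.2 : S1)

variable {Γ : ℝ → MHat}

theorem IsMotion.contDiff_familyLift (hΓ : IsMotion Γ) : ContDiff ℝ ∞ (familyLift Γ) := hΓ

theorem Ds_eq_dirDeriv_snd {V : Type} [NormedAddCommGroup V] [NormedSpace ℝ V] {G : ℝ × ℝ → V}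
    (hG : ContDiff ℝ ∞ G) {f : S1 → V} {t : ℝ} (h : ∀ s : ℝ, f (s : S1) = G (t, s)) (s : ℝ) :
    Ds f (s : S1) = dirDeriv (0, 1) G (t, s) := by
  refine Ds_eq_of_hasDerivAt ?_
  rw [funext h]
  exact hasDerivAt_dirDeriv_snd (hG.differentiable (by simp)) t s

theorem IsMotion.tangent_coe (hΓ : IsMotion Γ) (t s : ℝ) :
    tangent (Γ t) (s : S1) = dirDeriv (0, 1) (familyLift Γ) (t, s) :=
  Ds_eq_dirDeriv_snd hΓ.contDiff_familyLift (fun _ => rfl) s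

theorem IsMotion.Ds_tangent_coe (hΓ : IsMotion Γ) (t s : ℝ) :
    Ds (tangent (Γ t)) (s : S1) = dirDeriv (0, 1) (dirDeriv (0, 1) (familyLift Γ)) (t, s) :=
  Ds_eq_dirDeriv_snd (contDiff_dirDeriv hΓ.contDiff_familyLift _) (hΓ.tangent_coe t) s

theorem IsMotion.initialVelocity_coe (hΓ : IsMotion Γ) (s : ℝ) :
    initialVelocity Γ (s : S1) = dirDeriv (1, 0) (familyLift Γ) (0, s) :=
  (hasDerivAt_dirDeriv_fst (hΓ.contDiff_familyLift.differentiable (by simp)) 0 s).deriv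

theorem IsMotion.smooth_initialVelocity (hΓ : IsMotion Γ) : Smooth (initialVelocity Γ) := by
  rw [Smooth, funext hΓ.initialVelocity_coe]
  exact (contDiff_dirDeriv hΓ.contDiff_familyLift _).comp (contDiff_prodMk_right 0)

theorem IsMotion.Ds_initialVelocity_coe (hΓ : IsMotion Γ) (s : ℝ) :
    Ds (initialVelocity Γ) (s : S1) =
      dirDeriv (1, 0) (dirDeriv (0, 1) (familyLift Γ)) (0, s) := by
  rw [dirDeriv_comm (contDiff_infty.1 hΓ.contDiff_familyLift 2)]
  exact Ds_eq_dirDeriv_snd (contDiff_dirDeriv hΓ.contDiff_familyLift _) hΓ.initialVelocity_coe s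

theorem IsMotion.Ds_Ds_initialVelocity_coe (hΓ : IsMotion Γ) (s : ℝ) :
    Ds (Ds (initialVelocity Γ)) (s : S1) =
      dirDeriv (1, 0) (dirDeriv (0, 1) (dirDeriv (0, 1) (familyLift Γ))) (0, s) := by
  have hT : ContDiff ℝ ∞ (dirDeriv (0, 1) (familyLift Γ)) :=
    contDiff_dirDeriv hΓ.contDiff_familyLift _
  rw [dirDeriv_comm (contDiff_infty.1 hT 2)]
  exact Ds_eq_dirDeriv_snd (contDiff_dirDeriv hT _) hΓ.Ds_initialVelocity_coe s

theorem IsMotion.hasDerivAt_tangent (hΓ : IsMotion Γ) (s : S1) :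
    HasDerivAt (fun t => tangent (Γ t) s) (Ds (initialVelocity Γ) s) 0 := by
  obtain ⟨x, rfl⟩ := QuotientAddGroup.mk_surjective s
  have hT : ContDiff ℝ ∞ (dirDeriv (0, 1) (familyLift Γ)) :=
    contDiff_dirDeriv hΓ.contDiff_familyLift _
  have h := hasDerivAt_dirDeriv_fst (hT.differentiable (by simp)) 0 x
  rwa [← hΓ.Ds_initialVelocity_coe, ← funext fun t => hΓ.tangent_coe t x] at h

theorem IsMotion.inner_Ds_initialVelocity_tangent (hΓ : IsMotion Γ) (s : S1) :
    ⟪Ds (initialVelocity Γ) s, tangent (Γ 0) s⟫ = 0 := by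
  have h := (hΓ.hasDerivAt_tangent s).inner ℝ (hΓ.hasDerivAt_tangent s)
  simp only [inner_tangent_tangent] at h
  have hsum := h.unique (hasDerivAt_const 0 1)
  rw [real_inner_comm] at hsum
  linarith

theorem IsMotion.initialVelocity_mem_tangentSpace (hΓ : IsMotion Γ) :
    initialVelocity Γ ∈ tangentSpace (Γ 0) :=
  mem_tangentSpace_iff.2 ⟨hΓ.smooth_initialVelocity, hΓ.inner_Ds_initialVelocity_tangent⟩

theorem HHat1_eq_intervalIntegral (γ : MHat) :
    HHat1 γ = (1 / 4) * ∫ s in (0 : ℝ)..(2 * Real.pi),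
      ⟪Ds (tangent γ) (s : S1), Ds (tangent γ) (s : S1)⟫ := by
  simp only [HHat1, integral_eq_intervalIntegral, intervalIntegral.integral_const_mul, Ds_tangent,
    real_inner_smul_left, real_inner_smul_right, inner_normal_normal, mul_one, sq]

theorem IsMotion.hasDerivAt_HHat1 (hΓ : IsMotion Γ) :
    HasDerivAt (fun t => HHat1 (Γ t)) (omegaHat1 (tangent (Γ 0)) (initialVelocity Γ)) 0 := by
  have hK : ContDiff ℝ ∞ (dirDeriv (0, 1) (dirDeriv (0, 1) (familyLift Γ))) :=
    contDiff_dirDeriv (contDiff_dirDeriv hΓ.contDiff_familyLift _) _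
  have h := (hasDerivAt_intervalIntegral_inner_self (hK.of_le (by simp)) 0 (2 * Real.pi)
    0).const_mul (1 / 4)
  simp only [HHat1_eq_intervalIntegral, omegaHat1, integral_eq_intervalIntegral,
    hΓ.Ds_tangent_coe, hΓ.Ds_Ds_initialVelocity_coe]
  exact h.congr_deriv (by ring)

theorem omegaHat1_const_smul_left (a : ℝ) {X : S1 → E2} (hX : Smooth X) (Y : S1 → E2) :
    omegaHat1 (fun s => a • X s) Y = omegaHat1 X Y * a := by
  simp only [omegaHat1, Ds_const_smul hX, real_inner_smul_left, integral_const_mul]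
  ring

/-- The moment map of the rotation action, `∂/∂σ ↦ Ĥ₁`. -/
def momentMap (γ : MHat) : Module.Dual ℝ ℝ := HHat1 γ • LinearMap.id

theorem isMomentMap_momentMap : IsMomentMap omegaHat1 momentMap where
  differential := by
    rintro a γ Y - Γ hΓ rfl rfl
    refine (hΓ.hasDerivAt_HHat1.mul_const a).congr_deriv ?_
    rw [← omegaHat1_const_smul_left a (smooth_tangent _), ← fundamentalField_eq]
  equivariant σ γ := by rw [momentMap, momentMap, HHat1_vadd]

end Motion

section RegularFamily

/-- A smooth family `s ↦ b (t, s)` of closed regular curves, not necessarily of unit speed, lifted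
to `ℝ × ℝ`. -/
structure IsRegularFamily (b : ℝ × ℝ → E2) : Prop where
  contDiff : ContDiff ℝ ∞ b
  periodic : ∀ t, Function.Periodic (fun s => b (t, s)) (2 * Real.pi)
  deriv_ne_zero : ∀ p, dirDeriv (0, 1) b p ≠ 0

/-- The speed `|b_s|`. -/
def speed (b : ℝ × ℝ → E2) (p : ℝ × ℝ) : ℝ := ‖dirDeriv (0, 1) b p‖

/-- The length of the arc of `b (t, ·)` from `0` to `s`, at `p = (t, s)`. -/
def arclength (b : ℝ × ℝ → E2) (p : ℝ × ℝ) : ℝ := ∫ x in (0 : ℝ)..p.2, speed b (p.1, x)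

/-- The factor by which `b (t, ·)` has to be scaled to have total length `2π`. -/
def lengthScale (b : ℝ × ℝ → E2) (t : ℝ) : ℝ := 2 * Real.pi / arclength b (t, 2 * Real.pi)

/-- The arclength parameter of `b (t, ·)` after scaling to total length `2π`. -/
def normalizedArclength (b : ℝ × ℝ → E2) (p : ℝ × ℝ) : ℝ := lengthScale b p.1 * arclength b p

namespace IsRegularFamily

variable {b : ℝ × ℝ → E2} (hb : IsRegularFamily b)

include hb

theorem differentiable : Differentiable ℝ b := hb.contDiff.differentiable (by simp)

theorem speed_pos (p : ℝ × ℝ) : 0 < speed b p := norm_pos_iff.2 (hb.deriv_ne_zero p)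

theorem contDiff_speed : ContDiff ℝ ∞ (speed b) :=
  (contDiff_dirDeriv hb.contDiff (0, 1)).norm ℝ hb.deriv_ne_zero

theorem continuous_speed (t : ℝ) : Continuous fun s => speed b (t, s) :=
  hb.contDiff_speed.continuous.comp (.prodMk_right t)

theorem periodic_speed (t : ℝ) : Function.Periodic (fun s => speed b (t, s)) (2 * Real.pi) :=
  (periodic_dirDeriv_snd hb.differentiable (hb.periodic t)).comp norm

theorem contDiff_arclength : ContDiff ℝ ∞ (arclength b) := contDiff_primitive hb.contDiff_speed

theorem hasDerivAt_arclength (t s : ℝ) :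
    HasDerivAt (fun s => arclength b (t, s)) (speed b (t, s)) s :=
  (hb.continuous_speed t).integral_hasStrictDerivAt 0 s |>.hasDerivAt

theorem arclength_two_pi_pos (t : ℝ) : 0 < arclength b (t, 2 * Real.pi) :=
  intervalIntegral.intervalIntegral_pos_of_pos ((hb.continuous_speed t).intervalIntegrable _ _)
    (fun s => hb.speed_pos (t, s)) Real.two_pi_pos

theorem arclength_add_two_pi (t s : ℝ) :
    arclength b (t, s + 2 * Real.pi) = arclength b (t, s) + arclength b (t, 2 * Real.pi) := by
  simpa only [arclength, zero_add] using (hb.periodic_speed t).intervalIntegral_add_eq_add 0 s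
    fun u v => (hb.continuous_speed t).intervalIntegrable u v

theorem surjective_arclength (t : ℝ) : Function.Surjective fun s => arclength b (t, s) := by
  have hcont : Continuous fun s => arclength b (t, s) :=
    hb.contDiff_arclength.continuous.comp (.prodMk_right t)
  have hint := (hb.continuous_speed t).intervalIntegrable (μ := volume) 0 (2 * Real.pi)
  exact hcont.surjective
    ((hb.periodic_speed t).tendsto_atTop_intervalIntegral_of_pos' hint
      (fun s => hb.speed_pos (t, s)) Real.two_pi_pos)
    ((hb.periodic_speed t).tendsto_atBot_intervalIntegral_of_pos' hint
      (fun s => hb.speed_pos (t, s)) Real.two_pi_pos)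

theorem lengthScale_pos (t : ℝ) : 0 < lengthScale b t :=
  div_pos Real.two_pi_pos (hb.arclength_two_pi_pos t)

theorem contDiff_lengthScale : ContDiff ℝ ∞ (lengthScale b) :=
  contDiff_const.div (hb.contDiff_arclength.comp (contDiff_prodMk_left _))
    fun t => (hb.arclength_two_pi_pos t).ne'

theorem contDiff_normalizedArclength : ContDiff ℝ ∞ (normalizedArclength b) :=
  (hb.contDiff_lengthScale.comp contDiff_fst).mul hb.contDiff_arclength

theorem hasDerivAt_normalizedArclength (t s : ℝ) :
    HasDerivAt (fun s => normalizedArclength b (t, s)) (lengthScale b t * speed b (t, s)) s :=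
  (hb.hasDerivAt_arclength t s).const_mul (lengthScale b t)

theorem dirDeriv_snd_normalizedArclength_pos (p : ℝ × ℝ) :
    0 < dirDeriv (0, 1) (normalizedArclength b) p := by
  have hd : Differentiable ℝ (normalizedArclength b) :=
    hb.contDiff_normalizedArclength.differentiable (by simp)
  rw [(hasDerivAt_dirDeriv_snd hd p.1 p.2).unique (hb.hasDerivAt_normalizedArclength p.1 p.2)]
  exact mul_pos (hb.lengthScale_pos p.1) (hb.speed_pos p)

theorem normalizedArclength_add_two_pi (t s : ℝ) :
    normalizedArclength b (t, s + 2 * Real.pi) = normalizedArclength b (t, s) + 2 * Real.pi := by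
  have total : lengthScale b t * arclength b (t, 2 * Real.pi) = 2 * Real.pi :=
    div_mul_cancel₀ _ (hb.arclength_two_pi_pos t).ne'
  rw [normalizedArclength, hb.arclength_add_two_pi, mul_add, total, normalizedArclength]

theorem surjective_normalizedArclength (t : ℝ) :
    Function.Surjective fun s => normalizedArclength b (t, s) :=
  (mul_left_surjective₀ (hb.lengthScale_pos t).ne').comp (hb.surjective_arclength t)

end IsRegularFamily

theorem exists_isMotion_of_lift {G : ℝ × ℝ → E2} (hG : ContDiff ℝ ∞ G)
    (hper : ∀ t, Function.Periodic (fun s => G (t, s)) (2 * Real.pi))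
    (hunit : ∀ p, ‖dirDeriv (0, 1) G p‖ = 1) : ∃ Γ, IsMotion Γ ∧ familyLift Γ = G := by
  have mem_MHat (t : ℝ) : (hper t).lift ∈ MHat := by
    refine ⟨hG.comp (contDiff_prodMk_right t), fun s => ?_⟩
    obtain ⟨x, rfl⟩ := QuotientAddGroup.mk_surjective s
    rw [real_inner_self_eq_norm_sq, Ds_eq_dirDeriv_snd hG (fun s => (hper t).lift_coe s) x, hunit,
      one_pow]
  exact ⟨fun t => ⟨(hper t).lift, mem_MHat t⟩, hG, rfl⟩

theorem IsRegularFamily.exists_isMotion {b : ℝ × ℝ → E2} (hb : IsRegularFamily b) :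
    ∃ Γ, IsMotion Γ ∧ ∀ t s,
      familyLift Γ (t, normalizedArclength b (t, s)) = lengthScale b t • b (t, s) := by
  obtain ⟨θ, hθ, θ_normalizedArclength⟩ :=
    exists_contDiff_fiberwise_inverse (by simp) hb.contDiff_normalizedArclength
      hb.dirDeriv_snd_normalizedArclength_pos hb.surjective_normalizedArclength
  let G : ℝ × ℝ → E2 := fun p => lengthScale b p.1 • b (p.1, θ p)
  have hG : ContDiff ℝ ∞ G :=
    (hb.contDiff_lengthScale.comp contDiff_fst).smul (hb.contDiff.comp (contDiff_fst.prodMk hθ))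
  have G_normalizedArclength (t s : ℝ) :
      G (t, normalizedArclength b (t, s)) = lengthScale b t • b (t, s) := by
    simp only [G, θ_normalizedArclength]
  have hper (t : ℝ) : Function.Periodic (fun u => G (t, u)) (2 * Real.pi) := fun u => by
    obtain ⟨s, rfl⟩ := hb.surjective_normalizedArclength t u
    simp only [← hb.normalizedArclength_add_two_pi, G_normalizedArclength, hb.periodic t s]
  have hunit (p : ℝ × ℝ) : ‖dirDeriv (0, 1) G p‖ = 1 := by
    obtain ⟨t, u⟩ := p
    obtain ⟨s, rfl⟩ := hb.surjective_normalizedArclength t u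
    have chain := (hasDerivAt_dirDeriv_snd (hG.differentiable (by simp)) t _).scomp s
      (hb.hasDerivAt_normalizedArclength t s)
    rw [show (fun u => G (t, u)) ∘ (fun s => normalizedArclength b (t, s)) =
      fun s => lengthScale b t • b (t, s) from funext (G_normalizedArclength t)] at chain
    have hderiv := congrArg norm <|
      chain.unique ((hasDerivAt_dirDeriv_snd hb.differentiable t s).const_smul (lengthScale b t))
    have hpos := mul_pos (hb.lengthScale_pos t) (hb.speed_pos (t, s))
    rw [norm_smul, norm_smul, Real.norm_of_nonneg hpos.le,
      Real.norm_of_nonneg (hb.lengthScale_pos t).le] at hderiv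
    exact mul_left_cancel₀ hpos.ne' (hderiv.trans (mul_one _).symm)
  obtain ⟨Γ, hΓ, hlift⟩ := exists_isMotion_of_lift hG hper hunit
  exact ⟨Γ, hΓ, fun t s => (congrFun hlift _).trans (G_normalizedArclength t s)⟩

section EvenSpeed

variable {b : ℝ × ℝ → E2}

theorem even_arclength (heven : ∀ s, Function.Even fun t => speed b (t, s)) (s : ℝ) :
    Function.Even fun t => arclength b (t, s) := fun t => by
  simp only [arclength, fun x => heven x t]

theorem even_lengthScale (heven : ∀ s, Function.Even fun t => speed b (t, s)) :
    Function.Even (lengthScale b) := fun t => by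
  simp only [lengthScale, even_arclength heven _ t]

theorem even_normalizedArclength (heven : ∀ s, Function.Even fun t => speed b (t, s)) (s : ℝ) :
    Function.Even fun t => normalizedArclength b (t, s) := fun t => by
  simp only [normalizedArclength, even_lengthScale heven t, even_arclength heven s t]

theorem arclength_zero (hunit : ∀ s, speed b (0, s) = 1) (s : ℝ) : arclength b (0, s) = s := by
  simp [arclength, hunit]

theorem lengthScale_zero (hunit : ∀ s, speed b (0, s) = 1) : lengthScale b 0 = 1 := by
  rw [lengthScale, arclength_zero hunit, div_self Real.two_pi_pos.ne']

theorem normalizedArclength_zero (hunit : ∀ s, speed b (0, s) = 1) (s : ℝ) :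
    normalizedArclength b (0, s) = s := by
  rw [normalizedArclength, lengthScale_zero hunit, arclength_zero hunit, one_mul]

theorem IsRegularFamily.exists_isMotion_of_even_speed (hb : IsRegularFamily b)
    (heven : ∀ s, Function.Even fun t => speed b (t, s)) (hunit : ∀ s, speed b (0, s) = 1) :
    ∃ Γ, IsMotion Γ ∧ ∀ s : ℝ, (Γ 0).1 (s : S1) = b (0, s) ∧
      initialVelocity Γ (s : S1) = dirDeriv (1, 0) b (0, s) := by
  obtain ⟨Γ, hΓ, hlift⟩ := hb.exists_isMotion
  have hΓ₀ (s : ℝ) : familyLift Γ (0, s) = b (0, s) := by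
    simpa only [normalizedArclength_zero hunit, lengthScale_zero hunit, one_smul] using hlift 0 s
  refine ⟨Γ, hΓ, fun s => ⟨hΓ₀ s, ?_⟩⟩
  have hparam : HasDerivAt (fun t => normalizedArclength b (t, s)) 0 0 :=
    hasDerivAt_zero_of_even (even_normalizedArclength heven s)
      ((hb.contDiff_normalizedArclength.comp (contDiff_prodMk_left s)).differentiable (by simp) 0)
  have hscale : HasDerivAt (lengthScale b) 0 0 := hasDerivAt_zero_of_even (even_lengthScale heven)
    (hb.contDiff_lengthScale.differentiable (by simp) 0)
  have hleft : HasDerivAt (fun t => familyLift Γ (t, normalizedArclength b (t, s)))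
      (dirDeriv (1, 0) (familyLift Γ) (0, normalizedArclength b (0, s))) 0 :=
    (hΓ.contDiff_familyLift.differentiable (by simp) _).hasFDerivAt.comp_hasDerivAt (0 : ℝ)
      ((hasDerivAt_id (0 : ℝ)).prodMk hparam)
  have hright := hscale.smul (hasDerivAt_dirDeriv_fst hb.differentiable 0 s)
  rw [lengthScale_zero hunit, one_smul, zero_smul, add_zero] at hright
  rw [funext fun t => hlift t s, normalizedArclength_zero hunit] at hleft
  rw [hΓ.initialVelocity_coe]
  exact hleft.unique hright

end EvenSpeed

end RegularFamily

section LinearVariation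

/-- The variation `γ + t Y` of `γ` in the direction of the field `Y`. -/
def linearVariation (γ : MHat) (Y : S1 → E2) (p : ℝ × ℝ) : E2 := γ.1 (p.2 : S1) + p.1 • Y (p.2 : S1)

variable {γ : MHat} {Y : S1 → E2}

theorem contDiff_linearVariation (hY : Smooth Y) : ContDiff ℝ ∞ (linearVariation γ Y) :=
  (γ.2.1.comp contDiff_snd).add (contDiff_fst.smul (hY.comp contDiff_snd))

theorem dirDeriv_fst_linearVariation (hY : Smooth Y) (t s : ℝ) :
    dirDeriv (1, 0) (linearVariation γ Y) (t, s) = Y (s : S1) := by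
  have hd := (contDiff_linearVariation (γ := γ) hY).differentiable (by simp)
  refine (hasDerivAt_dirDeriv_fst hd t s).unique ?_
  exact (((hasDerivAt_id t).smul_const (Y (s : S1))).const_add (γ.1 (s : S1))).congr_deriv
    (one_smul ℝ _)

theorem dirDeriv_snd_linearVariation (hY : Smooth Y) (t s : ℝ) :
    dirDeriv (0, 1) (linearVariation γ Y) (t, s) = tangent γ (s : S1) + t • Ds Y (s : S1) := by
  have hd := (contDiff_linearVariation (γ := γ) hY).differentiable (by simp)
  exact (hasDerivAt_dirDeriv_snd hd t s).unique
    ((γ.2.1.hasDerivAt s).add ((hY.hasDerivAt s).const_smul t))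

theorem speed_linearVariation (hY : Smooth Y) (horth : ∀ s, ⟪Ds Y s, tangent γ s⟫ = 0) (t s : ℝ) :
    speed (linearVariation γ Y) (t, s) = √(1 + t ^ 2 * ‖Ds Y (s : S1)‖ ^ 2) := by
  have h : ⟪tangent γ (s : S1), t • Ds Y (s : S1)⟫ = 0 := by
    rw [real_inner_smul_right, real_inner_comm, horth, mul_zero]
  rw [speed, dirDeriv_snd_linearVariation hY, ← Real.sqrt_sq (norm_nonneg _), norm_add_sq_real, h,
    norm_tangent, norm_smul, mul_pow, Real.norm_eq_abs, sq_abs]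
  ring_nf

theorem isRegularFamily_linearVariation (hY : Smooth Y)
    (horth : ∀ s, ⟪Ds Y s, tangent γ s⟫ = 0) : IsRegularFamily (linearVariation γ Y) where
  contDiff := contDiff_linearVariation hY
  periodic t s := by simp only [linearVariation, AddCircle.coe_add_period]
  deriv_ne_zero := by
    rintro ⟨t, s⟩
    refine norm_pos_iff.1 (?_ : 0 < speed (linearVariation γ Y) (t, s))
    rw [speed_linearVariation hY horth]
    positivity

theorem exists_isMotion_of_mem_tangentSpace (hY : Y ∈ tangentSpace γ) :
    ∃ Γ : ℝ → MHat, IsMotion Γ ∧ Γ 0 = γ ∧ initialVelocity Γ = Y := by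
  obtain ⟨hsmooth, horth⟩ := mem_tangentSpace_iff.1 hY
  have hspeed := speed_linearVariation hsmooth horth
  obtain ⟨Γ, hΓ, hΓ₀⟩ := (isRegularFamily_linearVariation hsmooth
    horth).exists_isMotion_of_even_speed (fun s t => by simp only [hspeed, neg_sq])
    (fun s => by simp [hspeed])
  refine ⟨Γ, hΓ, Subtype.ext (funext fun s => ?_), funext fun s => ?_⟩ <;>
    obtain ⟨x, rfl⟩ := QuotientAddGroup.mk_surjective s
  · simpa [linearVariation] using (hΓ₀ x).1
  · exact (hΓ₀ x).2.trans (dirDeriv_fst_linearVariation hsmooth 0 x)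

theorem tangentSpace_eq_initialVelocities (γ : MHat) : tangentSpace γ =
    {Y | ∃ Γ : ℝ → MHat, IsMotion Γ ∧ Γ 0 = γ ∧ initialVelocity Γ = Y} := by
  refine Set.Subset.antisymm (fun Y hY => exists_isMotion_of_mem_tangentSpace hY) ?_
  rintro Y ⟨Γ, hΓ, rfl, rfl⟩
  exact hΓ.initialVelocity_mem_tangentSpace

end LinearVariation

end

end PlaneCurves

open PlaneCurves in
theorem theorem4p3 :
    -- the tangent space consists exactly of the velocities of smooth motions
    (∀ γ : MHat, tangentSpace γ =
      {Y | ∃ Γ : ℝ → MHat, IsMotion Γ ∧ Γ 0 = γ ∧ initialVelocity Γ = Y}) ∧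
    -- the expression of the form through the recursion operator
    (∀ (γ : MHat) (lam mu lam' mu' : S1 → ℝ),
      IsTangentPair γ lam mu → IsTangentPair γ lam' mu' →
        omegaHat1 (frameField γ lam mu) (frameField γ lam' mu') =
          ∫ s : S1, (curvature γ s * lam s + Ds mu s) * OmegaHat γ lam' mu' s) ∧
    -- the action preserves the form
    (∀ (σ : S1) (γ : MHat), ∀ X ∈ tangentSpace γ, ∀ Y ∈ tangentSpace γ,
      shift σ X ∈ tangentSpace (σ +ᵥ γ) ∧ shift σ Y ∈ tangentSpace (σ +ᵥ γ) ∧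
        omegaHat1 (shift σ X) (shift σ Y) = omegaHat1 X Y) ∧
    -- the fundamental vector fields are tangent, and the moment map is given by `HHat1`
    (∀ (a : ℝ) (γ : MHat), fundamentalField a γ ∈ tangentSpace γ) ∧
    ∃ μ : MHat → Module.Dual ℝ ℝ, IsMomentMap omegaHat1 μ ∧ ∀ γ : MHat, μ γ 1 = HHat1 γ := by
  exact ⟨tangentSpace_eq_initialVelocities,
    fun _ _ _ _ _ h h' => omegaHat1_frameField h h',
    fun σ _ X hX Y hY =>
      ⟨shift_mem_tangentSpace hX σ, shift_mem_tangentSpace hY σ, omegaHat1_shift σ X Y⟩,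
    fundamentalField_mem_tangentSpace, momentMap, isMomentMap_momentMap,
    fun γ => by simp [momentMap]⟩
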